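/- Let $\mathbb{S}=\mathbb{R}/\mathbb{Z}$ and, for $k\in\mathbb{N}$, let $H^k(\mathbb{S})$ be the Sobolev space of real functions $f\in L^2(\mathbb{S})$ whose weak derivatives of order at most $k$ are in $L^2(\mathbb{S})$, with norm $\|f\|_{H^k(\mathbb{S})}=\big(\sum_{j=0}^{k}\|\partial_x^jf\|_{L^2(\mathbb{S})}^2\big)^{1/2}$. For $c>0$, $T\in(0,\infty]$ and $u_0\in H^3(\mathbb{S})$, consider solutions $u\in C^0([0,T),H^3(\mathbb{S}))\cap C^1([0,T),H^2(\mathbb{S}))$ of the periodic problem $$u_t-u_{txx}+c\,u\,u_x=c\,u\,u_{xxx}\quad (0<t<T,\ x\in\mathbb{S}),\qquad u(0,\cdot)=u_0,$$ where, for each $t$, the equation holds for almost every $x$. For every $M>0$ there are constants $K,A>0$, depending only on $M$, such that the following holds for all $c>0$, $T\in(0,\infty]$, $u_0\in H^3(\mathbb{S})$ and every such solution $u$. If $$\|u(t,\cdot)\|_{L^\infty(\mathbb{S})}+\|u_x(t,\cdot)\|_{L^\infty(\mathbb{S})}<M\qquad\text{for all } t\in[0,T),$$ then $\|u\|_{H^3(\mathbb{S})}$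 does not blow up in finite time: for every finite $S\le T$, $$\sup_{0\le t<S}\|u(t,\cdot)\|_{H^3(\mathbb{S})}<\infty ,$$ and, quantitatively, $$\|u(t,\cdot)\|_{H^3(\mathbb{S})}\le K e^{cAt}\|u_0\|_{H^3(\mathbb{S})}\qquad\text{for all } t\in[0,T).$$ -/

import Mathlib

open MeasureTheory Set
open scoped ContDiff

noncomputable section

namespace ZeroEquation

/-- The circle is `UnitAddCircle = ℝ / ℤ` with its Lebesgue measure of total mass one;
`CircleL2` is the real Hilbert space of square integrable functions on it. -/
abbrev CircleL2 : Type := Lp ℝ 2 (volume : Measure UnitAddCircle)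

/-- A smooth real function on the circle: its 1-periodic lift to the line is smooth. -/
def IsSmooth (φ : UnitAddCircle → ℝ) : Prop :=
  ContDiff ℝ ∞ (fun y : ℝ => φ (y : UnitAddCircle))

/-- The classical derivative of order `j` of a function on the circle. -/
def circleDeriv (j : ℕ) (φ : UnitAddCircle → ℝ) (x : UnitAddCircle) : ℝ :=
  iteratedDeriv j (fun y : ℝ => φ (x + (y : UnitAddCircle))) 0

theorem circleDeriv_coe (j : ℕ) (φ : UnitAddCircle → ℝ) (a : ℝ) :
    circleDeriv j φ (a : UnitAddCircle) =
      iteratedDeriv j (fun y : ℝ => φ (y : UnitAddCircle)) a := by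
  have h := congrFun (iteratedDeriv_comp_const_add j (fun y : ℝ => φ (y : UnitAddCircle)) a) 0
  simpa [circleDeriv] using h

theorem IsSmooth.continuous_circleDeriv {φ : UnitAddCircle → ℝ} (hφ : IsSmooth φ) (j : ℕ) :
    Continuous (circleDeriv j φ) := by
  have hq : Topology.IsQuotientMap ((↑) : ℝ → UnitAddCircle) := isQuotientMap_quotient_mk'
  rw [hq.continuous_iff]
  have : circleDeriv j φ ∘ ((↑) : ℝ → UnitAddCircle) =
      iteratedDeriv j (fun y : ℝ => φ (y : UnitAddCircle)) :=
    funext fun a => circleDeriv_coe j φ a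
  rw [this]
  exact ContDiff.continuous_iteratedDeriv j hφ (by exact_mod_cast le_top)

theorem IsSmooth.continuous {φ : UnitAddCircle → ℝ} (hφ : IsSmooth φ) : Continuous φ := by
  have h := hφ.continuous_circleDeriv 0
  have : circleDeriv 0 φ = φ := by
    funext x
    simp [circleDeriv]
  rwa [this] at h

theorem integrable_mul_of_continuous (f : CircleL2) {ψ : UnitAddCircle → ℝ}
    (hψ : Continuous ψ) : Integrable (fun x => f x * ψ x) volume := by
  have hf : MemLp (f : UnitAddCircle → ℝ) 2 volume := Lp.memLp f
  have hψ2 : MemLp ψ 2 (volume : Measure UnitAddCircle) :=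
    hψ.memLp_of_hasCompactSupport (HasCompactSupport.of_compactSpace ψ)
  exact hf.integrable_mul hψ2

/-- `g` is the weak (distributional) derivative of order `j` of `f` on the circle. -/
def IsWeakDeriv (j : ℕ) (f g : CircleL2) : Prop :=
  ∀ φ : UnitAddCircle → ℝ, IsSmooth φ →
    ∫ x, f x * circleDeriv j φ x = (-1) ^ j * ∫ x, g x * φ x

theorem integral_add_mul (f g : CircleL2) {ψ : UnitAddCircle → ℝ} (hψ : Continuous ψ) :
    ∫ x, (f + g : CircleL2) x * ψ x = (∫ x, f x * ψ x) + ∫ x, g x * ψ x := by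
  rw [← integral_add (integrable_mul_of_continuous f hψ) (integrable_mul_of_continuous g hψ)]
  refine integral_congr_ae ?_
  filter_upwards [Lp.coeFn_add f g] with x hx
  rw [hx, Pi.add_apply, add_mul]

theorem integral_smul_mul (r : ℝ) (f : CircleL2) (ψ : UnitAddCircle → ℝ) :
    ∫ x, (r • f : CircleL2) x * ψ x = r * ∫ x, f x * ψ x := by
  rw [← integral_const_mul]
  refine integral_congr_ae ?_
  filter_upwards [Lp.coeFn_smul r f] with x hx
  rw [hx, Pi.smul_apply, smul_eq_mul, mul_assoc]

theorem integral_zero_mul (ψ : UnitAddCircle → ℝ) :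
    ∫ x, (0 : CircleL2) x * ψ x = 0 := by
  have h := integral_smul_mul 0 0 ψ
  rwa [zero_smul, zero_mul] at h

/-- The Sobolev space of order `k` on the circle. An element is a function `f` in `L²` recorded
together with its weak derivatives `(f, f', …, f⁽ᵏ⁾)`, all in `L²`; these are determined by `f`.
The norm it carries is `(∑_{j ≤ k} ‖f⁽ʲ⁾‖²_{L²})^{1/2}`. -/
def sobolev (k : ℕ) : Submodule ℝ (PiLp 2 fun _ : Fin (k + 1) => CircleL2) where
  carrier := {w | ∀ j : Fin (k + 1), IsWeakDeriv j (w 0) (w j)}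
  zero_mem' := by
    intro j φ _
    simp only [PiLp.zero_apply]
    rw [integral_zero_mul, integral_zero_mul, mul_zero]
  add_mem' := by
    intro v w hv hw j φ hφ
    simp only [PiLp.add_apply]
    rw [integral_add_mul _ _ (hφ.continuous_circleDeriv j),
      integral_add_mul _ _ hφ.continuous, hv j φ hφ, hw j φ hφ, mul_add]
  smul_mem' := by
    intro r w hw j φ hφ
    simp only [PiLp.smul_apply]
    rw [integral_smul_mul, integral_smul_mul, hw j φ hφ]
    ring

/-- `H k` is the Sobolev space of order `k` on the circle, as a normed space. -/
abbrev H (k : ℕ) : Type := sobolev k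

/-- The weak derivative of order `j ≤ k` of an element of `H k` (order `0` is the function). -/
def H.d {k : ℕ} (j : Fin (k + 1)) (f : H k) : CircleL2 :=
  (f : PiLp 2 fun _ : Fin (k + 1) => CircleL2) j

/-- The inclusion of `H³` into `H²`: the function stays, the third derivative is forgotten. -/
def inclH2 (f : H 3) : H 2 :=
  ⟨WithLp.toLp 2 fun j : Fin 3 => f.d j.castSucc, fun j => f.2 j.castSucc⟩

/-- The time interval `[0, T)`, for `T` finite or `T = ∞`. -/
def timeInterval (T : EReal) : Set ℝ := {t | 0 ≤ t ∧ (t : EReal) < T}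

/-- The time derivative `u_t`, one-sided at `t = 0`, taken in `H²`. -/
def timeDeriv (T : EReal) (u : ℝ → H 3) (t : ℝ) : H 2 :=
  derivWithin (fun s => inclH2 (u s)) (timeInterval T) t

/-- `u` is a solution in `C⁰([0,T), H³) ∩ C¹([0,T), H²)` of the 1-periodic problem
`u_t - u_txx + c u u_x = c u u_xxx`, `u(0) = u₀`. Every term of the equation is in `L²` of the
circle for each time, and the equation is understood almost everywhere in space. -/
structure IsSolution (c : ℝ) (T : EReal) (u₀ : H 3) (u : ℝ → H 3) : Prop where
  continuousOn : ContinuousOn u (timeInterval T)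
  contDiffOn : ContDiffOn ℝ 1 (fun t => inclH2 (u t)) (timeInterval T)
  initial : u 0 = u₀
  equation : ∀ t ∈ timeInterval T, 0 < t → ∀ᵐ x : UnitAddCircle,
    (timeDeriv T u t).d 0 x - (timeDeriv T u t).d 2 x + c * (u t).d 0 x * (u t).d 1 x
      = c * (u t).d 0 x * (u t).d 3 x

/-- The norm of `L^∞` of the circle. -/
def supNorm (f : CircleL2) : ENNReal := eLpNorm f ⊤ volume

end ZeroEquation

end

open ZeroEquation

noncomputable section

namespace ZeroEquation

open MeasureTheory Set Filter Topology
open scoped ContDiff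

/-! The momentum `m = u - u_xx` satisfies the transport equation `m_t = -c u m_x`, and by
integration by parts `‖m‖² + ‖m_x‖²` is equivalent to the squared `H³` norm of `u`. So it suffices
to bound `m` and `m_x` in `L²`.

For `m`, the energy identity gives `d/dt ‖m‖² = c ∫ u_x m² ≤ c M ‖m‖²`. For `m_x` the equation
cannot be differentiated in space, since `m_x` is only in `L²`. Instead the energy of the increment
`m(· + h) - m` grows at rate at most `3 c M h² ‖m_x‖²` (`abs_two_inner_translate_sub_le`).
Integrating in time, dividing by `h²` and letting `h → 0` gives an integral inequality for `‖m_x‖²`,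
closed by Gronwall.

All spatial calculus goes through translations: a weak derivative is the derivative at `0` of `h ↦
f(· + h)` in `L²` (`IsWeakDeriv.hasDerivAt_translate`). Translation invariance of the inner product
then replaces product rules for weak derivatives. -/

/-! ### Translations on `L²`. -/

/-- Translation `f ↦ f(· + h)` on `L²` of the circle. -/
def translate (h : ℝ) : CircleL2 →ₗᵢ[ℝ] CircleL2 :=
  Lp.compMeasurePreservingₗᵢ ℝ (fun x : UnitAddCircle => x + (h : UnitAddCircle))
    (measurePreserving_add_right volume (h : UnitAddCircle))

theorem coeFn_translate (h : ℝ) (f : CircleL2) :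
    (translate h f : UnitAddCircle → ℝ) =ᵐ[volume] fun x => f (x + (h : UnitAddCircle)) :=
  Lp.coeFn_compMeasurePreserving f (measurePreserving_add_right volume (h : UnitAddCircle))

theorem continuous_translate (f : CircleL2) : Continuous fun h : ℝ => translate h f := by
  have hg : Continuous fun h : ℝ =>
      (⟨fun x : UnitAddCircle => x + (h : UnitAddCircle), by fun_prop⟩ :
        C(UnitAddCircle, UnitAddCircle)) := by
    refine ContinuousMap.continuous_of_continuous_uncurry _ ?_
    exact continuous_snd.add ((AddCircle.continuous_mk' 1).comp continuous_fst)
  exact (continuous_const (y := f)).compMeasurePreservingLp hg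
    (fun h => measurePreserving_add_right volume (h : UnitAddCircle)) (by simp)

theorem ae_translate {p : UnitAddCircle → Prop} (h : ℝ) (hp : ∀ᵐ x, p x) :
    ∀ᵐ x : UnitAddCircle, p (x + (h : UnitAddCircle)) :=
  (measurePreserving_add_right volume (h : UnitAddCircle)).quasiMeasurePreserving.ae hp

theorem translate_add (a b : ℝ) (f : CircleL2) :
    translate (a + b) f = translate a (translate b f) := by
  refine Lp.ext ?_
  filter_upwards [coeFn_translate (a + b) f, coeFn_translate a (translate b f),
    ae_translate a (coeFn_translate b f)] with x h1 h2 h3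
  rw [h1, h2, h3, AddCircle.coe_add, add_assoc]

theorem translate_zero (f : CircleL2) : translate 0 f = f := by
  refine Lp.ext ?_
  filter_upwards [coeFn_translate 0 f] with x hx
  rw [hx, AddCircle.coe_zero, add_zero]

/-! ### Smooth test functions. -/

/-- An `L²` function orthogonal to all smooth functions vanishes. -/
theorem eq_zero_of_forall_integral_mul_smooth {f : CircleL2}
    (hf : ∀ φ : UnitAddCircle → ℝ, IsSmooth φ → ∫ x, f x * φ x = 0) : f = 0 := by
  have hG : MemLp (fun x => (f x : ℂ)) 2 (AddCircle.haarAddCircle (T := (1 : ℝ))) :=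
    memLp_haarAddCircle_iff.2 (Lp.memLp f).ofReal
  have hfour : ∀ (n : ℤ) (y : ℝ), (fourier n (y : UnitAddCircle) : ℂ)
      = Complex.exp (2 * Real.pi * Complex.I * n * y) := by
    intro n y; rw [fourier_coe_apply]; simp
  have hsm : ∀ n : ℤ, ContDiff ℝ ∞ (fun y : ℝ => (fourier n (y : UnitAddCircle) : ℂ)) := by
    intro n
    simp only [hfour]
    exact (contDiff_const.mul Complex.ofRealCLM.contDiff).cexp
  have hre : ∀ n : ℤ, IsSmooth (fun x => (fourier n x : ℂ).re) := fun n =>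
    Complex.reCLM.contDiff.comp (hsm n)
  have him : ∀ n : ℤ, IsSmooth (fun x => (fourier n x : ℂ).im) := fun n =>
    Complex.imCLM.contDiff.comp (hsm n)
  -- The real and imaginary parts of each character are admissible tests, so every Fourier
  -- coefficient vanishes.
  have hcoef : ∀ n : ℤ, fourierCoeff (hG.toLp _) n = 0 := by
    intro n
    rw [fourierCoeff_congr_ae hG.coeFn_toLp, fourierCoeff, AddCircle.integral_haarAddCircle]
    have : ∀ x : UnitAddCircle, (fourier (-n) x : ℂ) • (f x : ℂ)
        = ((f x * (fourier (-n) x : ℂ).re : ℝ) : ℂ)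
          + ((f x * (fourier (-n) x : ℂ).im : ℝ) : ℂ) * Complex.I := by
      intro x
      conv_lhs => rw [← Complex.re_add_im (fourier (-n) x : ℂ)]
      push_cast [smul_eq_mul]
      ring
    simp only [this]
    rw [integral_add, integral_mul_const, integral_complex_ofReal, integral_complex_ofReal, hf _ (hre _),
      hf _ (him _)]
    · simp
    · exact (integrable_mul_of_continuous f (hre _).continuous).ofReal
    · exact (integrable_mul_of_continuous f (him _).continuous).ofReal.mul_const _
  have hz : hG.toLp _ = 0 := by
    apply (fourierBasis (T := (1 : ℝ))).repr.injective
    ext n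
    rw [fourierBasis_repr, hcoef]
    simp
  have h0 := (hG.coeFn_toLp).symm.trans (hz ▸ Lp.coeFn_zero ℂ 2 _)
  have hv : (volume : Measure UnitAddCircle) = AddCircle.haarAddCircle := by
    rw [AddCircle.volume_eq_smul_haarAddCircle]; simp
  rw [← hv] at h0
  refine Lp.ext ?_
  filter_upwards [h0, Lp.coeFn_zero ℝ 2 (volume : Measure UnitAddCircle)] with x hx h2
  rw [h2]
  simpa using hx

theorem IsSmooth.circleDeriv {φ : UnitAddCircle → ℝ} (hφ : IsSmooth φ) (j : ℕ) :
    IsSmooth (circleDeriv j φ) := by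
  have : (fun y : ℝ => ZeroEquation.circleDeriv j φ (y : UnitAddCircle)) =
      iteratedDeriv j (fun y : ℝ => φ (y : UnitAddCircle)) :=
    funext fun a => circleDeriv_coe j φ a
  unfold IsSmooth
  rw [this, iteratedDeriv_eq_iterate]
  exact ContDiff.iterate_deriv j hφ

theorem circleDeriv_circleDeriv_one (j : ℕ) (φ : UnitAddCircle → ℝ) :
    circleDeriv j (circleDeriv 1 φ) = circleDeriv (j + 1) φ := by
  funext x
  induction x using QuotientAddGroup.induction_on with
  | H a =>
    erw [circleDeriv_coe, circleDeriv_coe]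
    have : (fun y : ℝ => circleDeriv 1 φ (y : UnitAddCircle)) =
        deriv (fun y : ℝ => φ (y : UnitAddCircle)) :=
      funext fun a => by rw [circleDeriv_coe, iteratedDeriv_one]
    rw [this, iteratedDeriv_succ']

theorem IsSmooth.hasDerivAt {φ : UnitAddCircle → ℝ} (hφ : IsSmooth φ) (x : UnitAddCircle) (h : ℝ) :
    HasDerivAt (fun y : ℝ => φ (x + (y : UnitAddCircle)))
      (ZeroEquation.circleDeriv 1 φ (x + (h : UnitAddCircle))) h := by
  induction x using QuotientAddGroup.induction_on with
  | H a =>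
    have h1 : HasDerivAt (fun y : ℝ => φ (y : UnitAddCircle))
        (ZeroEquation.circleDeriv 1 φ ((a + h : ℝ) : UnitAddCircle)) (a + h) := by
      rw [circleDeriv_coe, iteratedDeriv_one]
      exact (hφ.differentiable (by simp)).differentiableAt.hasDerivAt
    exact h1.comp_const_add a h

theorem IsSmooth.translate {φ : UnitAddCircle → ℝ} (hφ : IsSmooth φ) (h : ℝ) :
    IsSmooth (fun x => φ (x + (h : UnitAddCircle))) := by
  unfold IsSmooth
  exact ContDiff.comp (g := fun y : ℝ => φ (y : UnitAddCircle)) hφ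
    (contDiff_id.add contDiff_const)

theorem circleDeriv_one_translate (φ : UnitAddCircle → ℝ) (h : ℝ) (x : UnitAddCircle) :
    circleDeriv 1 (fun x => φ (x + (h : UnitAddCircle))) x
      = circleDeriv 1 φ (x + (h : UnitAddCircle)) := by
  simp only [circleDeriv]
  congr 1
  funext y
  congr 1
  abel

theorem integral_translate_mul (h : ℝ) (f : CircleL2) (φ : UnitAddCircle → ℝ) :
    ∫ x, translate h f x * φ x = ∫ x, f x * φ (x + ((-h : ℝ) : UnitAddCircle)) := by
  rw [← integral_add_right_eq_self
    (fun x => f x * φ (x + ((-h : ℝ) : UnitAddCircle))) (h : UnitAddCircle)]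
  refine integral_congr_ae ?_
  filter_upwards [coeFn_translate h f] with x hx
  simp [hx]

/-- Moving the translation onto `φ` allows differentiation under the integral. The sign from `φ(x -
s)` cancels the sign in the weak derivative, tested on the translate of `φ`. -/
theorem hasDerivAt_integral_translate_mul {f g : CircleL2} (hfg : IsWeakDeriv 1 f g)
    {φ : UnitAddCircle → ℝ} (hφ : IsSmooth φ) (h : ℝ) :
    HasDerivAt (fun s : ℝ => ∫ x, translate s f x * φ x) (∫ x, translate h g x * φ x) h := by
  simp only [integral_translate_mul]
  obtain ⟨C, hC⟩ : ∃ C, ∀ x, ‖circleDeriv 1 φ x‖ ≤ C := by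
    obtain ⟨C, hC⟩ := isCompact_univ.exists_bound_of_continuousOn
      (hφ.continuous_circleDeriv 1).continuousOn
    exact ⟨C, fun x => hC x (mem_univ x)⟩
  have hcont : ∀ {ψ : UnitAddCircle → ℝ} (s : ℝ), Continuous ψ →
      Continuous fun x => ψ (x + ((-s : ℝ) : UnitAddCircle)) := fun s hψ =>
    hψ.comp (continuous_id.add continuous_const)
  have key := (hasDerivAt_integral_of_dominated_loc_of_deriv_le (𝕜 := ℝ)
    (μ := (volume : Measure UnitAddCircle)) (s := univ) (x₀ := h)
    (F := fun s x => f x * φ (x + ((-s : ℝ) : UnitAddCircle)))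
    (F' := fun s x => f x * -circleDeriv 1 φ (x + ((-s : ℝ) : UnitAddCircle)))
    (bound := fun x => ‖f x‖ * C) univ_mem
    (Eventually.of_forall fun s =>
      (integrable_mul_of_continuous f (hcont s hφ.continuous)).aestronglyMeasurable)
    (integrable_mul_of_continuous f (hcont h hφ.continuous))
    (integrable_mul_of_continuous f
      (hcont h (hφ.continuous_circleDeriv 1)).neg).aestronglyMeasurable
    (Eventually.of_forall fun x s _ => by
      rw [norm_mul, norm_neg]
      exact mul_le_mul_of_nonneg_left (hC _) (norm_nonneg _))
    (((Lp.memLp f).integrable (by simp)).norm.mul_const C)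
    (Eventually.of_forall fun x s _ => by
      have h1 := ((hφ.hasDerivAt x (-s)).scomp s (hasDerivAt_neg s)).const_mul (f x)
      simpa [Function.comp_def] using h1)).2
  have h2 := hfg _ (hφ.translate (-h))
  simp only [circleDeriv_one_translate] at h2
  have h3 : ∫ x, f x * -circleDeriv 1 φ (x + ((-h : ℝ) : UnitAddCircle))
      = ∫ x, g x * φ (x + ((-h : ℝ) : UnitAddCircle)) := by
    simp only [mul_neg]
    rw [integral_neg, h2]
    ring
  rwa [h3] at key

theorem inner_eq_integral (f g : CircleL2) : inner ℝ f g = ∫ x, f x * g x := by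
  rw [L2.inner_def]
  refine integral_congr_ae (Eventually.of_forall fun x => ?_)
  simp [mul_comm]

theorem memLp_of_continuous {φ : UnitAddCircle → ℝ} (hφ : Continuous φ) :
    MemLp φ 2 (volume : Measure UnitAddCircle) :=
  hφ.memLp_of_hasCompactSupport (HasCompactSupport.of_compactSpace φ)

theorem inner_toLp (f : CircleL2) {φ : UnitAddCircle → ℝ} (hφ : Continuous φ) :
    inner ℝ f ((memLp_of_continuous hφ).toLp φ) = ∫ x, f x * φ x := by
  rw [inner_eq_integral]
  refine integral_congr_ae ?_
  filter_upwards [(memLp_of_continuous hφ).coeFn_toLp] with x hx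
  rw [hx]

/-! ### Weak derivatives as derivatives of translation orbits. -/

/-- A weak derivative is the derivative of the translation orbit in `L²`. -/
theorem IsWeakDeriv.hasDerivAt_translate {f g : CircleL2} (hfg : IsWeakDeriv 1 f g) (h : ℝ) :
    HasDerivAt (fun s => translate s f) (translate h g) h := by
  -- The integrated identity can be checked weakly, against smooth functions. Strong continuity of
  -- `s ↦ translate s g` then makes it strongly differentiable.
  have hint : ∀ a : ℝ, translate a f = f + ∫ s in (0 : ℝ)..a, translate s g := by
    intro a
    rw [← sub_eq_zero]
    refine eq_zero_of_forall_integral_mul_smooth fun φ hφ => ?_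
    have hi : IntervalIntegrable (fun s => translate s g) volume 0 a :=
      (continuous_translate g).intervalIntegrable _ _
    rw [← inner_toLp _ hφ.continuous, inner_sub_left, inner_add_left]
    set Φ := (memLp_of_continuous hφ.continuous).toLp φ with hΦ
    have h1 : inner ℝ (∫ s in (0 : ℝ)..a, translate s g) Φ
        = ∫ s in (0 : ℝ)..a, inner ℝ (translate s g) Φ := by
      have := (innerSL ℝ Φ).intervalIntegral_comp_comm hi
      simp only [innerSL_apply_apply] at this
      rw [real_inner_comm, ← this]
      simp only [real_inner_comm]
    have h2 : ∫ s in (0 : ℝ)..a, inner ℝ (translate s g) Φ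
        = inner ℝ (translate a f) Φ - inner ℝ (translate 0 f) Φ := by
      refine intervalIntegral.integral_eq_sub_of_hasDerivAt
        (f := fun s => inner ℝ (translate s f) Φ) (fun s _ => ?_) ?_
      · simp only [hΦ, inner_toLp _ hφ.continuous]
        exact hasDerivAt_integral_translate_mul hfg hφ s
      · exact ((continuous_translate g).inner continuous_const).intervalIntegrable _ _
    rw [h1, h2, translate_zero]
    ring
  have h3 := (intervalIntegral.integral_hasDerivAt_right
    ((continuous_translate g).intervalIntegrable 0 h)
    ((continuous_translate g).stronglyMeasurableAtFilter _ _)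
    (continuous_translate g).continuousAt).const_add f
  exact h3.congr_of_eventuallyEq (Eventually.of_forall hint)

theorem IsWeakDeriv.norm_translate_sub_le {f g : CircleL2} (hfg : IsWeakDeriv 1 f g) (h : ℝ) :
    ‖translate h f - f‖ ≤ ‖g‖ * |h| := by
  have := convex_univ.norm_image_sub_le_of_norm_hasDerivWithin_le
    (f := fun s => translate s f) (C := ‖g‖)
    (fun s _ => (hfg.hasDerivAt_translate s).hasDerivWithinAt)
    (fun s _ => ((translate s).norm_map g).le) (mem_univ 0) (mem_univ h)
  simpa [translate_zero] using this

/-- A function with weak derivative bounded by `M` is `M`-Lipschitz. -/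
theorem IsWeakDeriv.ae_abs_translate_sub_le {f g : CircleL2} (hfg : IsWeakDeriv 1 f g) {M : ℝ}
    (hM : ∀ᵐ x, |g x| ≤ M) (h : ℝ) :
    ∀ᵐ x, |(translate h f - f : CircleL2) x| ≤ M * |h| := by
  have hi : Integrable (translate h f - f : CircleL2) volume := (Lp.memLp _).integrable (by simp)
  -- Pairing the orbit with an indicator reduces to the scalar mean value inequality; bounds on the
  -- integrals over all sets give the pointwise bound.
  have key : ∀ s : Set UnitAddCircle, MeasurableSet s →
      |∫ x in s, (translate h f - f : CircleL2) x| ≤ M * volume.real s * |h| := by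
    intro s hs
    have hμ : (volume : Measure UnitAddCircle) s ≠ ⊤ := measure_ne_top _ _
    have hder : ∀ r ∈ univ, HasDerivWithinAt
        (fun r => inner ℝ (indicatorConstLp 2 hs hμ (1 : ℝ)) (translate r f))
        (inner ℝ (indicatorConstLp 2 hs hμ (1 : ℝ)) (translate r g)) univ r := fun r _ =>
      ((innerSL ℝ (indicatorConstLp 2 hs hμ (1 : ℝ))).hasFDerivAt.comp_hasDerivAt r
        (hfg.hasDerivAt_translate r)).hasDerivWithinAt
    have hb : ∀ r ∈ (univ : Set ℝ), ‖(inner ℝ (indicatorConstLp 2 hs hμ (1 : ℝ))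
        (translate r g) : ℝ)‖ ≤ M * volume.real s := by
      intro r _
      rw [L2.inner_indicatorConstLp_one]
      refine norm_setIntegral_le_of_norm_le_const_ae (measure_lt_top _ _) ?_
      refine ae_restrict_of_ae ?_
      filter_upwards [coeFn_translate r g, ae_translate r hM] with x h1 h2
      rwa [h1]
    have h3 := convex_univ.norm_image_sub_le_of_norm_hasDerivWithin_le hder hb
      (mem_univ 0) (mem_univ h)
    rw [← inner_sub_right, translate_zero, L2.inner_indicatorConstLp_one] at h3
    simpa using h3
  have h1 : ∀ᵐ x, (translate h f - f : CircleL2) x ≤ M * |h| := by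
    refine ae_le_of_forall_setIntegral_le hi (integrable_const _) fun s hs _ => ?_
    rw [setIntegral_const, smul_eq_mul]
    linarith [(abs_le.1 (key s hs)).2]
  have h2 : ∀ᵐ x, -(M * |h|) ≤ (translate h f - f : CircleL2) x := by
    refine ae_le_of_forall_setIntegral_le (integrable_const _) hi fun s hs _ => ?_
    rw [setIntegral_const, smul_eq_mul]
    linarith [(abs_le.1 (key s hs)).1]
  filter_upwards [h1, h2] with x h1 h2
  exact abs_le.2 ⟨h2, h1⟩

/-! ### Bounded multipliers and energy inequalities. -/

theorem memLp_mul_of_bound {a : CircleL2} {M : ℝ} (ha : ∀ᵐ x, |a x| ≤ M) (f : CircleL2) :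
    MemLp (fun x => a x * f x) 2 volume := by
  refine (Lp.memLp f).of_le_mul (c := M)
    ((Lp.aestronglyMeasurable a).mul (Lp.aestronglyMeasurable f)) ?_
  filter_upwards [ha] with x hx
  rw [norm_mul]
  exact mul_le_mul_of_nonneg_right hx (norm_nonneg _)

/-- Multiplication by an essentially bounded function, as an operator on `L²`. -/
def mulBdd (a : CircleL2) {M : ℝ} (ha : ∀ᵐ x, |a x| ≤ M) : CircleL2 →L[ℝ] CircleL2 :=
  LinearMap.mkContinuous
    { toFun := fun f => (memLp_mul_of_bound ha f).toLp _
      map_add' := fun f g => by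
        refine Lp.ext ?_
        filter_upwards [(memLp_mul_of_bound ha (f + g)).coeFn_toLp,
          Lp.coeFn_add ((memLp_mul_of_bound ha f).toLp _) ((memLp_mul_of_bound ha g).toLp _),
          (memLp_mul_of_bound ha f).coeFn_toLp, (memLp_mul_of_bound ha g).coeFn_toLp,
          Lp.coeFn_add f g] with x h1 h2 h3 h4 h5
        rw [h1, h2, Pi.add_apply, h3, h4, h5, Pi.add_apply, mul_add]
      map_smul' := fun r f => by
        refine Lp.ext ?_
        filter_upwards [(memLp_mul_of_bound ha (r • f)).coeFn_toLp,
          Lp.coeFn_smul r ((memLp_mul_of_bound ha f).toLp _),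
          (memLp_mul_of_bound ha f).coeFn_toLp, Lp.coeFn_smul r f] with x h1 h2 h3 h4
        simp only [RingHom.id_apply]
        rw [h1, h2, Pi.smul_apply, h3, h4, Pi.smul_apply, smul_eq_mul, smul_eq_mul]
        ring } M fun f => by
      refine Lp.norm_le_mul_norm_of_ae_le_mul ?_
      filter_upwards [(memLp_mul_of_bound ha f).coeFn_toLp, ha] with x h1 h2
      simp only [LinearMap.coe_mk, AddHom.coe_mk]
      rw [h1, norm_mul]
      exact mul_le_mul_of_nonneg_right h2 (norm_nonneg _)

section mulBdd

variable {a b : CircleL2} {M M' : ℝ}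

theorem coeFn_mulBdd (ha : ∀ᵐ x, |a x| ≤ M) (f : CircleL2) :
    (mulBdd a ha f : UnitAddCircle → ℝ) =ᵐ[volume] fun x => a x * f x :=
  (memLp_mul_of_bound ha f).coeFn_toLp

theorem norm_mulBdd_le (ha : ∀ᵐ x, |a x| ≤ M) (f : CircleL2) : ‖mulBdd a ha f‖ ≤ M * ‖f‖ := by
  refine Lp.norm_le_mul_norm_of_ae_le_mul ?_
  filter_upwards [coeFn_mulBdd ha f, ha] with x h1 h2
  rw [h1, norm_mul]
  exact mul_le_mul_of_nonneg_right h2 (norm_nonneg _)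

theorem inner_mulBdd_comm (ha : ∀ᵐ x, |a x| ≤ M) (f g : CircleL2) :
    inner ℝ (mulBdd a ha f) g = (inner ℝ (mulBdd a ha g) f : ℝ) := by
  rw [inner_eq_integral, inner_eq_integral]
  refine integral_congr_ae ?_
  filter_upwards [coeFn_mulBdd ha f, coeFn_mulBdd ha g] with x h1 h2
  rw [h1, h2]
  ring

/-- A discrete Leibniz rule. The translated coefficient is split as `a` plus its increment, which is
small when `a` is Lipschitz. -/
theorem translate_mulBdd (ha : ∀ᵐ x, |a x| ≤ M) (h : ℝ)
    (hb : ∀ᵐ x, |(translate h a - a : CircleL2) x| ≤ M') (f : CircleL2) :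
    translate h (mulBdd a ha f)
      = mulBdd a ha (translate h f) + mulBdd (translate h a - a) hb (translate h f) := by
  refine Lp.ext ?_
  filter_upwards [coeFn_translate h (mulBdd a ha f), ae_translate h (coeFn_mulBdd ha f),
    coeFn_translate h f, coeFn_translate h a, Lp.coeFn_sub (translate h a) a,
    coeFn_mulBdd ha (translate h f), coeFn_mulBdd hb (translate h f),
    Lp.coeFn_add (mulBdd a ha (translate h f)) (mulBdd (translate h a - a) hb (translate h f))]
    with x h1 h2 h3 h4 h5 h6 h7 h8
  rw [h1, h2, h8, Pi.add_apply, h6, h7, h5, Pi.sub_apply, h3, h4]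
  ring

/-- The inequality `|2 ∫ a w w'| ≤ M ‖w‖²` for `|a'| ≤ M`. -/
theorem abs_two_inner_mulBdd_le (ha : ∀ᵐ x, |a x| ≤ M) (hab : IsWeakDeriv 1 a b)
    (hb : ∀ᵐ x, |b x| ≤ M') {w q : CircleL2}
    (hw : HasDerivAt (fun s => translate s w) q 0) :
    |2 * inner ℝ (mulBdd a ha q) w| ≤ M' * ‖w‖ ^ 2 := by
  have hM' : 0 ≤ M' := by
    obtain ⟨x, hx⟩ := hb.exists
    exact (abs_nonneg _).trans hx
  -- The quantity to bound is the derivative at `0` of `s ↦ ∫ a (translate s w)²`, so a Lipschitz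
  -- bound at `0` is enough.
  have hN : HasDerivAt (fun s => inner ℝ (mulBdd a ha (translate s w)) (translate s w))
      (2 * inner ℝ (mulBdd a ha q) w) 0 := by
    have h1 := (((mulBdd a ha).hasFDerivAt).comp_hasDerivAt (0 : ℝ) hw).inner ℝ hw
    simp only [Function.comp_apply, translate_zero] at h1
    rw [two_mul]
    nth_rewrite 1 [inner_mulBdd_comm ha q w]
    exact h1
  have := hN.le_of_lip' (C := M' * ‖w‖ ^ 2) (by positivity) (Eventually.of_forall fun s => ?_)
  · simpa using this
  have hs := hab.ae_abs_translate_sub_le hb s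
  -- Translating both factors leaves the inner product unchanged, so only the increment of `a`
  -- contributes, and it is at most `M' |s|`.
  have h0 : (inner ℝ (mulBdd a ha w) w : ℝ)
      = inner ℝ (mulBdd a ha (translate s w)) (translate s w)
        + inner ℝ (mulBdd (translate s a - a) hs (translate s w)) (translate s w) := by
    rw [← inner_add_left, ← translate_mulBdd, LinearIsometry.inner_map_map]
  rw [translate_zero, h0, sub_add_cancel_left, norm_neg, sub_zero]
  calc _ ≤ ‖mulBdd (translate s a - a) hs (translate s w)‖ * ‖translate s w‖ :=
        norm_inner_le_norm _ _
    _ ≤ M' * |s| * ‖translate s w‖ * ‖translate s w‖ := by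
        gcongr
        exact norm_mulBdd_le hs _
    _ = M' * ‖w‖ ^ 2 * ‖s‖ := by
        rw [LinearIsometry.norm_map, Real.norm_eq_abs]
        ring

end mulBdd

/-- Integration by parts on the circle. -/
theorem inner_weakDeriv_left {f f' g g' : CircleL2} (hf : IsWeakDeriv 1 f f')
    (hg : IsWeakDeriv 1 g g') : (inner ℝ f g' : ℝ) = -inner ℝ f' g := by
  have h1 := (hf.hasDerivAt_translate 0).inner ℝ (hg.hasDerivAt_translate 0)
  simp only [LinearIsometry.inner_map_map] at h1
  have := h1.unique (hasDerivAt_const (0 : ℝ) (inner ℝ f g : ℝ))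
  linarith

/-- Transport of a difference quotient: energy inequality for the field `a w_x`. -/
theorem abs_two_inner_translate_sub_le {a b w q : CircleL2} {M : ℝ} (ha : ∀ᵐ x, |a x| ≤ M)
    (hab : IsWeakDeriv 1 a b) (hb : ∀ᵐ x, |b x| ≤ M) (hw : IsWeakDeriv 1 w q) (h : ℝ) :
    |2 * inner ℝ (translate h w - w) (translate h (mulBdd a ha q) - mulBdd a ha q)|
      ≤ 3 * M * h ^ 2 * ‖q‖ ^ 2 := by
  have hM : 0 ≤ M := by
    obtain ⟨x, hx⟩ := hb.exists
    exact (abs_nonneg _).trans hx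
  have hs := hab.ae_abs_translate_sub_le hb h
  -- Translations commute, so the increment of `w` has the increment of `q` as its derivative.
  have hF : HasDerivAt (fun s => translate s (translate h w - w)) (translate h q - q) 0 := by
    have h1 := hw.hasDerivAt_translate 0
    rw [translate_zero] at h1
    have h2 := ((translate h).toContinuousLinearMap.hasFDerivAt.comp_hasDerivAt (0 : ℝ) h1).sub h1
    refine h2.congr_of_eventuallyEq (Eventually.of_forall fun s => ?_)
    simp only [map_sub, Pi.sub_apply, Function.comp_apply, LinearIsometry.coe_toContinuousLinearMap]
    rw [← translate_add, ← translate_add, add_comm]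
  have h3 := abs_two_inner_mulBdd_le ha hab hb hF
  have h4 := hw.norm_translate_sub_le h
  have h5 : |(inner ℝ (mulBdd (translate h a - a) hs (translate h q)) (translate h w - w) : ℝ)|
      ≤ M * |h| * ‖q‖ * (‖q‖ * |h|) := by
    refine (abs_real_inner_le_norm _ _).trans ?_
    have := norm_mulBdd_le hs (translate h q)
    rw [LinearIsometry.norm_map] at this
    gcongr
  have h6 : M * ‖translate h w - w‖ ^ 2 ≤ M * (‖q‖ * |h|) ^ 2 := by gcongr
  -- Leibniz splitting: the transport term costs `M h² ‖q‖²` and the increment of `a` costs `2 M h²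
  -- ‖q‖²`, whence the constant `3`.
  have h7 : (2 * inner ℝ (translate h w - w) (translate h (mulBdd a ha q) - mulBdd a ha q) : ℝ)
      = 2 * inner ℝ (mulBdd a ha (translate h q - q)) (translate h w - w)
        + 2 * inner ℝ (mulBdd (translate h a - a) hs (translate h q)) (translate h w - w) := by
    rw [translate_mulBdd ha h hs, ← mul_add, ← inner_add_left, real_inner_comm, map_sub]
    congr 2
    abel
  rw [h7]
  refine (abs_add_le _ _).trans ?_
  rw [abs_mul (2 : ℝ) (inner ℝ (mulBdd (translate h a - a) hs _) _), abs_two]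
  have h8 : |h| * |h| = h ^ 2 := by rw [← sq, sq_abs]
  calc _ ≤ M * (‖q‖ * |h|) ^ 2 + 2 * (M * |h| * ‖q‖ * (‖q‖ * |h|)) := by
        linarith
    _ = 3 * M * (|h| * |h|) * ‖q‖ ^ 2 := by ring
    _ = _ := by rw [h8]

/-! ### Gronwall inequalities. -/

/-- Gronwall's inequality in differential form. -/
theorem le_mul_exp_of_hasDerivAt_le {y y' : ℝ → ℝ} {k b : ℝ} (hb : 0 ≤ b)
    (hy : ContinuousOn y (Icc 0 b)) (hy' : ∀ t ∈ Ioo 0 b, HasDerivAt y (y' t) t)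
    (hle : ∀ t ∈ Ioo 0 b, y' t ≤ k * y t) : y b ≤ y 0 * Real.exp (k * b) := by
  have hd : ∀ t ∈ Ioo 0 b, HasDerivAt (fun t => y t * Real.exp (-(k * t)))
      (y' t * Real.exp (-(k * t)) + y t * (Real.exp (-(k * t)) * -(k * 1))) t := fun t ht =>
    (hy' t ht).mul (((hasDerivAt_id t).const_mul k).neg.exp)
  have hanti : AntitoneOn (fun t => y t * Real.exp (-(k * t))) (Icc 0 b) := by
    refine antitoneOn_of_deriv_nonpos (convex_Icc 0 b) (hy.mul (by fun_prop)) ?_ ?_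
    · rw [interior_Icc]
      exact fun t ht => (hd t ht).differentiableAt.differentiableWithinAt
    · rw [interior_Icc]
      intro t ht
      rw [(hd t ht).deriv]
      have := mul_nonneg (sub_nonneg.2 (hle t ht)) (Real.exp_pos (-(k * t))).le
      linarith
  have h := hanti (left_mem_Icc.2 hb) (right_mem_Icc.2 hb) hb
  simp only [mul_zero, neg_zero, Real.exp_zero, mul_one] at h
  calc y b = y b * Real.exp (-(k * b)) * Real.exp (k * b) := by
        rw [mul_assoc, ← Real.exp_add]; simp
    _ ≤ _ := by gcongr

/-- Gronwall's inequality in integral form. -/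
theorem le_mul_exp_of_le_add_integral {z : ℝ → ℝ} {k b : ℝ} (hb : 0 ≤ b) (hk : 0 ≤ k)
    (hz : ContinuousOn z (Icc 0 b))
    (hle : ∀ t ∈ Icc 0 b, z t ≤ z 0 + k * ∫ s in (0 : ℝ)..t, z s) :
    z b ≤ z 0 * Real.exp (k * b) := by
  refine (hle b (right_mem_Icc.2 hb)).trans ?_
  have hint : IntegrableOn z (uIcc 0 b) := by
    rw [uIcc_of_le hb]; exact hz.integrableOn_Icc
  have h := le_mul_exp_of_hasDerivAt_le (y := fun t => z 0 + k * ∫ s in (0 : ℝ)..t, z s)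
    (y' := fun t => k * z t) (k := k) hb ?_ ?_ ?_
  · simpa using h
  · have := intervalIntegral.continuousOn_primitive_interval hint
    rw [uIcc_of_le hb] at this
    exact continuousOn_const.add (continuousOn_const.mul this)
  · intro t ht
    refine ((intervalIntegral.integral_hasDerivAt_right ?_ ?_ ?_).const_mul k).const_add (z 0)
    · refine ContinuousOn.intervalIntegrable (hz.mono ?_)
      rw [uIcc_of_le ht.1.le]
      exact Icc_subset_Icc_right ht.2.le
    · exact (hz.mono Ioo_subset_Icc_self).stronglyMeasurableAtFilter isOpen_Ioo t ht
    · exact hz.continuousAt (Icc_mem_nhds ht.1 ht.2)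
  · intro t ht
    exact mul_le_mul_of_nonneg_left (hle t (Ioo_subset_Icc_self ht)) hk

/-! ### Sobolev norms and the momentum. -/

theorem IsWeakDeriv.sub {f f' g g' : CircleL2} {j : ℕ} (hf : IsWeakDeriv j f f')
    (hg : IsWeakDeriv j g g') : IsWeakDeriv j (f - g) (f' - g') := by
  intro φ hφ
  have h1 : ∀ (a b : CircleL2), a - b = a + (-1 : ℝ) • b := fun a b => by
    rw [neg_one_smul, sub_eq_add_neg]
  rw [h1, h1, integral_add_mul _ _ (hφ.continuous_circleDeriv j),
    integral_add_mul _ _ hφ.continuous, integral_smul_mul, integral_smul_mul, hf φ hφ, hg φ hφ]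
  ring

/-- Membership in `sobolev k` relates each component only to the zeroth one. Testing order `j` on
`φ'` and order `j + 1` on `φ` links consecutive components. -/
theorem H.isWeakDeriv_one {k : ℕ} (f : H k) (j : Fin k) :
    IsWeakDeriv 1 (f.d j.castSucc) (f.d j.succ) := by
  intro φ hφ
  have h1 := f.2 j.castSucc _ (hφ.circleDeriv 1)
  have h2 := f.2 j.succ _ hφ
  rw [circleDeriv_circleDeriv_one] at h1
  rw [Fin.val_succ] at h2
  rw [Fin.val_castSucc] at h1
  have h3 := h1.symm.trans h2
  rw [pow_succ, mul_assoc] at h3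
  have := mul_left_cancel₀ (pow_ne_zero (j : ℕ) (by norm_num : (-1 : ℝ) ≠ 0)) h3
  rw [pow_one]
  exact this

/-- The weak derivative of order `j`, as a continuous linear map. -/
def H.dL {k : ℕ} (j : Fin (k + 1)) : H k →L[ℝ] CircleL2 :=
  (PiLp.proj 2 (fun _ : Fin (k + 1) => CircleL2) j).comp (sobolev k).subtypeL

theorem H.dL_apply {k : ℕ} (j : Fin (k + 1)) (f : H k) : H.dL j f = f.d j := rfl

/-- The momentum `u - u_xx`. -/
def momentum (f : H 3) : CircleL2 := f.d 0 - f.d 2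

/-- The derivative `u_x - u_xxx` of the momentum. -/
def momentumDeriv (f : H 3) : CircleL2 := f.d 1 - f.d 3

theorem isWeakDeriv_momentum (f : H 3) : IsWeakDeriv 1 (momentum f) (momentumDeriv f) :=
  (f.isWeakDeriv_one 0).sub (f.isWeakDeriv_one 2)

/-- Integration by parts turns the cross term `-2⟨f, k⟩` into `2‖g‖²`, so nothing cancels. -/
theorem norm_sub_sq_of_weakDeriv {f g k : CircleL2} (hfg : IsWeakDeriv 1 f g)
    (hgk : IsWeakDeriv 1 g k) : ‖f - k‖ ^ 2 = ‖f‖ ^ 2 + 2 * ‖g‖ ^ 2 + ‖k‖ ^ 2 := by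
  rw [norm_sub_sq_real, inner_weakDeriv_left hfg hgk, real_inner_self_eq_norm_sq]
  ring

theorem norm_sq_eq (f : H 3) :
    ‖f‖ ^ 2 = ‖f.d 0‖ ^ 2 + ‖f.d 1‖ ^ 2 + ‖f.d 2‖ ^ 2 + ‖f.d 3‖ ^ 2 := by
  have : ‖f‖ = ‖(f : PiLp 2 fun _ : Fin 4 => CircleL2)‖ := rfl
  rw [this, PiLp.norm_sq_eq_of_L2, Fin.sum_univ_four]
  rfl

theorem norm_momentum_sq (f : H 3) :
    ‖momentum f‖ ^ 2 = ‖f.d 0‖ ^ 2 + 2 * ‖f.d 1‖ ^ 2 + ‖f.d 2‖ ^ 2 :=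
  norm_sub_sq_of_weakDeriv (f.isWeakDeriv_one 0) (f.isWeakDeriv_one 1)

theorem norm_momentumDeriv_sq (f : H 3) :
    ‖momentumDeriv f‖ ^ 2 = ‖f.d 1‖ ^ 2 + 2 * ‖f.d 2‖ ^ 2 + ‖f.d 3‖ ^ 2 :=
  norm_sub_sq_of_weakDeriv (f.isWeakDeriv_one 1) (f.isWeakDeriv_one 2)

/-- The right side is the sum of the `‖f.d j‖²` with weights `1, 3, 3, 1`; this also explains the
`3` in the reverse bound. -/
theorem norm_sq_le_momentum (f : H 3) :
    ‖f‖ ^ 2 ≤ ‖momentum f‖ ^ 2 + ‖momentumDeriv f‖ ^ 2 := by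
  rw [norm_sq_eq, norm_momentum_sq, norm_momentumDeriv_sq]
  nlinarith [sq_nonneg ‖f.d 1‖, sq_nonneg ‖f.d 2‖]

theorem momentum_le_norm_sq (f : H 3) :
    ‖momentum f‖ ^ 2 + ‖momentumDeriv f‖ ^ 2 ≤ 3 * ‖f‖ ^ 2 := by
  rw [norm_sq_eq, norm_momentum_sq, norm_momentumDeriv_sq]
  nlinarith [sq_nonneg ‖f.d 0‖, sq_nonneg ‖f.d 3‖]

theorem Icc_subset_timeInterval {T : EReal} {b : ℝ} (hb : b ∈ timeInterval T) :
    Icc 0 b ⊆ timeInterval T := fun _ ht =>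
  ⟨ht.1, (EReal.coe_le_coe_iff.2 ht.2).trans_lt hb.2⟩

theorem ae_abs_le_of_supNorm {f : CircleL2} {M : ℝ} (hM : 0 ≤ M)
    (hf : supNorm f ≤ ENNReal.ofReal M) : ∀ᵐ x, |f x| ≤ M := by
  have h := ae_le_eLpNormEssSup (f := f) (μ := (volume : Measure UnitAddCircle))
  filter_upwards [h] with x hx
  rw [supNorm, eLpNorm_exponent_top] at hf
  have := hx.trans hf
  rwa [← ofReal_norm, ENNReal.ofReal_le_ofReal_iff hM] at this

/-! ### Energy estimates along a solution. -/

section Solution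

variable {c : ℝ} {T : EReal} {u₀ : H 3} {u : ℝ → H 3} {M b : ℝ}

theorem IsSolution.continuousOn_momentum (hu : IsSolution c T u₀ u) (hb : b ∈ timeInterval T) :
    ContinuousOn (fun t => momentum (u t)) (Icc 0 b) :=
  have h := hu.continuousOn.mono (Icc_subset_timeInterval hb)
  ((H.dL 0).continuous.comp_continuousOn h).sub ((H.dL 2).continuous.comp_continuousOn h)

theorem IsSolution.continuousOn_momentumDeriv (hu : IsSolution c T u₀ u)
    (hb : b ∈ timeInterval T) : ContinuousOn (fun t => momentumDeriv (u t)) (Icc 0 b) :=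
  have h := hu.continuousOn.mono (Icc_subset_timeInterval hb)
  ((H.dL 1).continuous.comp_continuousOn h).sub ((H.dL 3).continuous.comp_continuousOn h)

/-- The momentum `m` of a solution is transported: `m_t = -c u m_x` in `L²`. -/
theorem IsSolution.hasDerivAt_momentum (hu : IsSolution c T u₀ u) (hb : b ∈ timeInterval T)
    {t : ℝ} (ht : t ∈ Ioo 0 b) (ha : ∀ᵐ x, |(u t).d 0 x| ≤ M) :
    HasDerivAt (fun s => momentum (u s))
      (-(c • mulBdd ((u t).d 0) ha (momentumDeriv (u t)))) t := by
  have htT : t ∈ timeInterval T := Icc_subset_timeInterval hb (Ioo_subset_Icc_self ht)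
  -- At an interior time the derivative within the interval is a genuine derivative.
  have hnhds : timeInterval T ∈ 𝓝 t :=
    mem_of_superset (Icc_mem_nhds ht.1 ht.2) (Icc_subset_timeInterval hb)
  have h1 : HasDerivAt (fun s => inclH2 (u s)) (timeDeriv T u t) t :=
    ((hu.contDiffOn.differentiableOn (by norm_num)) t htT).hasDerivWithinAt.hasDerivAt hnhds
  have h2 := (H.dL 0 - H.dL 2 : H 2 →L[ℝ] CircleL2).hasFDerivAt.comp_hasDerivAt t h1
  have h3 : (H.dL 0 - H.dL 2 : H 2 →L[ℝ] CircleL2) (timeDeriv T u t)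
      = -(c • mulBdd ((u t).d 0) ha (momentumDeriv (u t))) := by
    rw [sub_apply, H.dL_apply, H.dL_apply]
    refine Lp.ext ?_
    filter_upwards [hu.equation t htT ht.1,
      Lp.coeFn_sub ((timeDeriv T u t).d 0) ((timeDeriv T u t).d 2),
      Lp.coeFn_neg (c • mulBdd ((u t).d 0) ha (momentumDeriv (u t))),
      Lp.coeFn_smul c (mulBdd ((u t).d 0) ha (momentumDeriv (u t))),
      coeFn_mulBdd ha (momentumDeriv (u t)), Lp.coeFn_sub ((u t).d 1) ((u t).d 3)]
      with x e1 e2 e3 e4 e5 e6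
    rw [e2, e3, Pi.sub_apply, Pi.neg_apply, e4, Pi.smul_apply, e5, momentumDeriv, e6,
      Pi.sub_apply, smul_eq_mul]
    linarith
  rw [h3] at h2
  exact h2

/-- Here `m` is differentiable in time in `L²`, so the differential form of Gronwall applies to
`‖m‖²`. -/
theorem IsSolution.norm_momentum_sq_le (hu : IsSolution c T u₀ u) (hc : 0 ≤ c)
    (hb : b ∈ timeInterval T) (h0 : ∀ t ∈ timeInterval T, ∀ᵐ x, |(u t).d 0 x| ≤ M)
    (h1 : ∀ t ∈ timeInterval T, ∀ᵐ x, |(u t).d 1 x| ≤ M) :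
    ‖momentum (u b)‖ ^ 2 ≤ ‖momentum (u 0)‖ ^ 2 * Real.exp (c * M * b) := by
  have hT : ∀ t ∈ Ioo 0 b, t ∈ timeInterval T := fun t ht =>
    Icc_subset_timeInterval hb (Ioo_subset_Icc_self ht)
  refine le_mul_exp_of_hasDerivAt_le (y := fun t => ‖momentum (u t)‖ ^ 2)
    (y' := fun t => 2 * inner ℝ (momentum (u t)) (deriv (fun s => momentum (u s)) t)) hb.1
    ((hu.continuousOn_momentum hb).norm.pow 2) (fun t ht => ?_) (fun t ht => ?_)
  · exact (hu.hasDerivAt_momentum hb ht (h0 t (hT t ht))).differentiableAt.hasDerivAt.norm_sq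
  · have ha := h0 t (hT t ht)
    rw [(hu.hasDerivAt_momentum hb ht ha).deriv]
    have hw := (isWeakDeriv_momentum (u t)).hasDerivAt_translate 0
    rw [translate_zero] at hw
    have h2 := abs_two_inner_mulBdd_le ha ((u t).isWeakDeriv_one 0) (h1 t (hT t ht)) hw
    rw [inner_neg_right, inner_smul_right, real_inner_comm]
    have h3 := mul_le_mul_of_nonneg_left ((neg_le_abs _).trans h2) hc
    linarith

/-- Only continuity in time of `m_x` is available, so its norm is reached through increments of `m`
and the integral form of Gronwall. -/
theorem IsSolution.norm_momentumDeriv_sq_le (hu : IsSolution c T u₀ u) (hc : 0 ≤ c)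
    (hM : 0 ≤ M) (hb : b ∈ timeInterval T) (h0 : ∀ t ∈ timeInterval T, ∀ᵐ x, |(u t).d 0 x| ≤ M)
    (h1 : ∀ t ∈ timeInterval T, ∀ᵐ x, |(u t).d 1 x| ≤ M) :
    ‖momentumDeriv (u b)‖ ^ 2 ≤ ‖momentumDeriv (u 0)‖ ^ 2 * Real.exp (3 * c * M * b) := by
  refine le_mul_exp_of_le_add_integral (z := fun t => ‖momentumDeriv (u t)‖ ^ 2) hb.1
    (by positivity) ((hu.continuousOn_momentumDeriv hb).norm.pow 2) fun t ht => ?_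
  have htT : t ∈ timeInterval T := Icc_subset_timeInterval hb ht
  have hT : ∀ s ∈ Ioo 0 t, s ∈ timeInterval T := fun s hs =>
    Icc_subset_timeInterval htT (Ioo_subset_Icc_self hs)
  set I := ∫ s in (0 : ℝ)..t, ‖momentumDeriv (u s)‖ ^ 2 with hI
  set Φ := ‖momentumDeriv (u 0)‖ ^ 2 + 3 * c * M * I with hΦ
  have hI0 : 0 ≤ I := intervalIntegral.integral_nonneg ht.1 fun s _ => sq_nonneg _
  have hΦ0 : 0 ≤ Φ := by positivity
  -- The factor `h²` is explicit and `Φ` does not depend on `h`, so the limit `h → 0` can be taken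
  -- afterwards.
  have hquot : ∀ h : ℝ, ‖translate h (momentum (u t)) - momentum (u t)‖ ^ 2 ≤ h ^ 2 * Φ := by
    intro h
    set L : CircleL2 →L[ℝ] CircleL2 :=
      (translate h).toContinuousLinearMap - ContinuousLinearMap.id ℝ CircleL2 with hL
    have hLa : ∀ f, L f = translate h f - f := fun f => rfl
    have hd : ∀ s ∈ Ioo 0 t, HasDerivAt (fun r => ‖L (momentum (u r))‖ ^ 2)
        (2 * inner ℝ (L (momentum (u s))) (L (deriv (fun r => momentum (u r)) s))) s :=
      fun s hs => (L.hasFDerivAt.comp_hasDerivAt s (hu.hasDerivAt_momentum htT hs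
        (h0 s (hT s hs))).differentiableAt.hasDerivAt).norm_sq
    have h2 := intervalIntegral.sub_le_integral_of_hasDeriv_right_of_le
      (φ := fun s => 3 * c * M * h ^ 2 * ‖momentumDeriv (u s)‖ ^ 2) ht.1
      ((L.continuous.comp_continuousOn (hu.continuousOn_momentum htT)).norm.pow 2)
      (fun s hs => (hd s hs).hasDerivWithinAt)
      (continuousOn_const.mul
        ((hu.continuousOn_momentumDeriv htT).norm.pow 2)).integrableOn_Icc
      (fun s hs => by
        have ha := h0 s (hT s hs)
        rw [(hu.hasDerivAt_momentum htT hs ha).deriv, map_neg, map_smul, inner_neg_right,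
          inner_smul_right, hLa, hLa]
        have h3 := abs_two_inner_translate_sub_le ha ((u s).isWeakDeriv_one 0) (h1 s (hT s hs))
          (isWeakDeriv_momentum (u s)) h
        have h4 := mul_le_mul_of_nonneg_left ((neg_le_abs _).trans h3) hc
        linarith)
    rw [intervalIntegral.integral_const_mul, ← hI] at h2
    simp only [Pi.pow_apply, Function.comp_apply] at h2
    rw [hLa, hLa] at h2
    have h5 := (isWeakDeriv_momentum (u 0)).norm_translate_sub_le h
    have h6 : ‖translate h (momentum (u 0)) - momentum (u 0)‖ ^ 2
        ≤ h ^ 2 * ‖momentumDeriv (u 0)‖ ^ 2 := by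
      refine (pow_le_pow_left₀ (norm_nonneg _) h5 2).trans_eq ?_
      rw [mul_pow, sq_abs, mul_comm]
    rw [hΦ]
    linarith
  have hder := (isWeakDeriv_momentum (u t)).hasDerivAt_translate 0
  rw [translate_zero] at hder
  -- The orbit of `m` is `√Φ`-Lipschitz at `0`, so its derivative `m_x` has norm at most `√Φ`.
  have h7 := hder.le_of_lip' (C := √Φ) (Real.sqrt_nonneg _) (Eventually.of_forall fun h => by
    rw [translate_zero, sub_zero]
    refine le_of_sq_le_sq ?_ (by positivity)
    rw [mul_pow, Real.sq_sqrt hΦ0, Real.norm_eq_abs, sq_abs, mul_comm]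
    exact hquot h)
  calc ‖momentumDeriv (u t)‖ ^ 2 ≤ √Φ ^ 2 := by gcongr
    _ = Φ := Real.sq_sqrt hΦ0

theorem IsSolution.norm_le (hu : IsSolution c T u₀ u) (hc : 0 ≤ c)
    (hM : 0 ≤ M) (hb : b ∈ timeInterval T) (h0 : ∀ t ∈ timeInterval T, ∀ᵐ x, |(u t).d 0 x| ≤ M)
    (h1 : ∀ t ∈ timeInterval T, ∀ᵐ x, |(u t).d 1 x| ≤ M) :
    ‖u b‖ ≤ 2 * Real.exp (c * (2 * M) * b) * ‖u₀‖ := by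
  have hb0 : 0 ≤ b := hb.1
  have e1 := hu.norm_momentum_sq_le hc hb h0 h1
  have e2 := hu.norm_momentumDeriv_sq_le hc hM hb h0 h1
  have e3 := norm_sq_le_momentum (u b)
  have e4 := momentum_le_norm_sq (u 0)
  rw [hu.initial] at e1 e2 e4
  have hcMb : 0 ≤ c * M * b := by positivity
  -- Both rates, `1` and `3` times `c M`, are rounded up to `4`, whose square root is the rate `2 c
  -- M`; likewise `3 ≤ 2²` gives the prefactor `2`.
  have e5 : Real.exp (c * M * b) ≤ Real.exp (4 * (c * M * b)) := Real.exp_le_exp.2 (by linarith)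
  have e6 : Real.exp (3 * c * M * b) ≤ Real.exp (4 * (c * M * b)) :=
    Real.exp_le_exp.2 (by linarith)
  have e7 : Real.exp (c * (2 * M) * b) ^ 2 = Real.exp (4 * (c * M * b)) := by
    rw [← Real.exp_nat_mul]; congr 1; push_cast; ring
  refine le_of_sq_le_sq ?_ (by positivity)
  rw [mul_pow, mul_pow, e7]
  calc ‖u b‖ ^ 2 ≤ ‖momentum u₀‖ ^ 2 * Real.exp (c * M * b)
        + ‖momentumDeriv u₀‖ ^ 2 * Real.exp (3 * c * M * b) := by linarith
    _ ≤ ‖momentum u₀‖ ^ 2 * Real.exp (4 * (c * M * b))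
        + ‖momentumDeriv u₀‖ ^ 2 * Real.exp (4 * (c * M * b)) := by gcongr
    _ = (‖momentum u₀‖ ^ 2 + ‖momentumDeriv u₀‖ ^ 2) * Real.exp (4 * (c * M * b)) := by ring
    _ ≤ (3 * ‖u₀‖ ^ 2) * Real.exp (4 * (c * M * b)) := by gcongr
    _ ≤ 2 ^ 2 * Real.exp (4 * (c * M * b)) * ‖u₀‖ ^ 2 := by
        nlinarith [mul_nonneg (sq_nonneg ‖u₀‖) (Real.exp_pos (4 * (c * M * b))).le]

end Solution

end ZeroEquation

end

/-! ### The main theorem. -/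

theorem theorem2p2 (M : ℝ) (hM : 0 < M) :
    ∃ K A : ℝ, 0 < K ∧ 0 < A ∧
      ∀ (c : ℝ), 0 < c → ∀ (T : EReal), 0 < T → ∀ (u₀ : H 3) (u : ℝ → H 3),
        IsSolution c T u₀ u →
        (∀ t ∈ timeInterval T,
          supNorm ((u t).d 0) + supNorm ((u t).d 1) < ENNReal.ofReal M) →
        (∀ t ∈ timeInterval T, ‖u t‖ ≤ K * Real.exp (c * A * t) * ‖u₀‖) ∧
        (∀ S : ℝ, (S : EReal) ≤ T → BddAbove ((fun t => ‖u t‖) '' Set.Ico 0 S)) := by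
  refine ⟨2, 2 * M, two_pos, by positivity, fun c hc T _ u₀ u hu hbound => ?_⟩
  have hmain : ∀ t ∈ timeInterval T,
      ‖u t‖ ≤ 2 * Real.exp (c * (2 * M) * t) * ‖u₀‖ := fun t ht =>
    hu.norm_le hc.le hM.le ht
      (fun s hs => ae_abs_le_of_supNorm hM.le (le_self_add.trans (hbound s hs).le))
      (fun s hs => ae_abs_le_of_supNorm hM.le (le_add_self.trans (hbound s hs).le))
  -- The exponential bound is increasing in time, so its value at `S` serves even when `S = T` lies
  -- outside the interval.
  refine ⟨hmain, fun S hS => ⟨2 * Real.exp (c * (2 * M) * S) * ‖u₀‖, ?_⟩⟩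
  rintro _ ⟨t, ht, rfl⟩
  refine (hmain t ⟨ht.1, (EReal.coe_lt_coe_iff.2 ht.2).trans_le hS⟩).trans ?_
  have := ht.2.le
  gcongr
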